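/- Let $X$ be a nonempty Tychonoff space, and let $C_p(X)$ be the set of continuous functions $X\to\mathbb R$ with the topology of pointwise convergence. Conventions. For collections $\mathcal A,\mathcal B$ of subsets of a given set, $S_{fin}(\mathcal A,\mathcal B)$ means: for every sequence $(A_n)_{n\in\mathbb N}$ of elements of $\mathcal A$ there are finite sets $B_n\subseteq A_n$ with $\bigcup_n B_n\in\mathcal B$. For a topological space $Z$ and $z\in Z$: - $\mathcal D$ is the family of dense subsets of $Z$; $\mathcal S$ is the family of sequentially dense subsets of $Z$, i.e. of those $A\subseteq Z$ such that every point of $Z$ is the limit of a sequence of points of $A$. $Z$ is sequentially separable if it has a countable sequentially dense subset. - $\Omega_z=\{A\subseteq Z: z\in\overline A\setminus A\}$, and $\Gamma_z$ is the family of infinite sets $A\subseteq Z$ with $z\notin A$ such that $A\setminus U$ is finite for every neighbourhood $U$ of $z$. $S_{fin}(\Gamma_x,\Omega_x)$ and $S_{fin}(\mathcal S,\Omega_x)$, written without specifying $x$, mean that the property holds for every point $x$ of the space. A cover of $X$ is a family $\mathcal U$ of subsets of $X$ with $\bigcup\mathcal U=X$ and $X\notin\mathcal U$. It is an $\omega$-cover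 if every finite subset of $X$ is contained in a member of $\mathcal U$, and a $\gamma$-cover if it is infinite and each $x\in X$ belongs to all but finitely many members of $\mathcal U$. A zero-set of $X$ is a set $f^{-1}(0)$ with $f:X\to\mathbb R$ continuous, and a cozero-set is the complement of a zero-set. $\Omega$ is the family of $\omega$-covers of $X$ by open sets. $\Gamma_F$ is the family of $\gamma$-covers $\mathcal U$ of $X$ by cozero-sets for which there are zero-sets $F(U)\subseteq U$ $(U\in\mathcal U)$ such that $\{F(U):U\in\mathcal U\}$ is a $\gamma$-cover of $X$. $X$ has property $V$ if there is a continuous bijection $f$ of $X$ onto a separable metric space $Y$ such that $f(U)$ is an $F_\sigma$-subset of $Y$ for every cozero-set $U$ of $X$. Theorem. The following are equivalent: 1. $C_p(X)$ is sequentially separable and satisfies $S_{fin}(\mathcal S,\mathcal D)$; 2. $X$ satisfies $S_{fin}(\Gamma_F,\Omega)$ and has property $V$; 3. $C_p(X)$ is sequentially separable and satisfies $S_{fin}(\Gamma_x,\Omega_x)$; 4. $C_p(X)$ is sequentially separable and satisfies $S_{fin}(\mathcal S,\Omega_x)$. -/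

import Mathlib

open Set Filter Topology

universe u

/-- The space `C_p(X)`: the continuous real-valued functions on `X` with the topology of pointwise
convergence (the subspace topology inherited from the product `X → ℝ`). -/
abbrev Cp (X : Type u) [TopologicalSpace X] : Type u := {f : X → ℝ // Continuous f}

/-- The selection principle `S_fin(𝒜, ℬ)` for two collections of subsets of `α`. -/
def SelFin {α : Type u} (𝒜 ℬ : Set (Set α)) : Prop :=
  ∀ A : ℕ → Set α, (∀ n, A n ∈ 𝒜) →
    ∃ B : ℕ → Set α, (∀ n, (B n).Finite ∧ B n ⊆ A n) ∧ (⋃ n, B n) ∈ ℬ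

section Points

variable (X : Type u) [TopologicalSpace X]

/-- `𝒟`: the dense subsets of `X`. -/
def DenseSets : Set (Set X) := {A | Dense A}

/-- `𝒮`: the sequentially dense subsets of `X`, that is, the sets `A` such that every point of `X`
is the limit of a sequence of points of `A`. -/
def SeqDenseSets : Set (Set X) := {A | seqClosure A = univ}

/-- `X` is sequentially separable: it has a countable sequentially dense subset. -/
def SeqSeparable : Prop := ∃ A : Set X, A.Countable ∧ A ∈ SeqDenseSets X

variable {X}

/-- `Ω_x`: the sets `A` with `x ∈ closure A \ A`. -/
def OmegaAt (x : X) : Set (Set X) := {A | x ∈ closure A \ A}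

/-- `Γ_x`: the sets `A` that converge to `x`. -/
def GammaAt (x : X) : Set (Set X) :=
  {A | A.Infinite ∧ x ∉ A ∧ ∀ U ∈ 𝓝 x, (A \ U).Finite}

end Points

section Covers

variable {X : Type u}

/-- A cover of `X` (always nontrivial: `X` itself is not a member). -/
def IsNontrivialCover (𝒰 : Set (Set X)) : Prop := ⋃₀ 𝒰 = univ ∧ univ ∉ 𝒰

/-- A `γ`-cover of `X` by arbitrary sets. -/
def IsGammaCover (𝒰 : Set (Set X)) : Prop :=
  IsNontrivialCover 𝒰 ∧ 𝒰.Infinite ∧ ∀ x : X, {U ∈ 𝒰 | x ∉ U}.Finite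

/-- An `ω`-cover of `X` by arbitrary sets. -/
def IsOmegaCover (𝒰 : Set (Set X)) : Prop :=
  IsNontrivialCover 𝒰 ∧ ∀ K : Set X, K.Finite → ∃ U ∈ 𝒰, K ⊆ U

variable [TopologicalSpace X]

/-- A zero-set: the preimage of `0` under a continuous real-valued function. -/
def IsZeroSet (Z : Set X) : Prop := ∃ f : X → ℝ, Continuous f ∧ Z = f ⁻¹' {0}

/-- A cozero-set: the complement of a zero-set. -/
def IsCozeroSet (U : Set X) : Prop := IsZeroSet Uᶜ

/-- An `F_σ`-set: a countable union of closed sets. -/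
def IsFSigma (A : Set X) : Prop := ∃ C : ℕ → Set X, (∀ n, IsClosed (C n)) ∧ A = ⋃ n, C n

variable (X)

/-- `Ω`: the open `ω`-covers of `X`. -/
def OpenOmegaCovers : Set (Set (Set X)) := {𝒰 | (∀ U ∈ 𝒰, IsOpen U) ∧ IsOmegaCover 𝒰}

/-- `Γ_F`: the `γ_F`-shrinkable `γ`-covers of `X`. -/
def ShrinkableGammaCovers : Set (Set (Set X)) :=
  {𝒰 | (∀ U ∈ 𝒰, IsCozeroSet U) ∧ IsGammaCover 𝒰 ∧
    ∃ F : Set X → Set X, (∀ U ∈ 𝒰, IsZeroSet (F U) ∧ F U ⊆ U) ∧ IsGammaCover (F '' 𝒰)}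

/-- Property `V`: there is a continuous bijection `f` of `X` onto a separable metric space `Y` that
maps every cozero-set of `X` to an `F_σ`-subset of `Y`. -/
def PropertyV : Prop :=
  ∃ (Y : Type u) (_ : MetricSpace Y) (_ : TopologicalSpace.SeparableSpace Y) (f : X → Y),
    Continuous f ∧ Function.Bijective f ∧ ∀ U : Set X, IsCozeroSet U → IsFSigma (f '' U)

end Covers

/-!
Order the subsets of `X` by the filter generated by the families `{U | K ⊆ U}`, `K` finite. A
`γ`-cover is a sequence of sets converging along this filter, and an `ω`-cover accumulates at it, so
`S_fin(Γ_F, Ω)` says of this filter what `S_fin(Γ_x, Ω_x)` says of the neighbourhood filter of a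
point `x` of `C_p(X)`. The sets `{|f - g| < 1/n}` carry sequences converging to `g` to shrinkable
`γ`-covers. Conversely, let `d` be a sequence reaching every point of `C_p(X)`, let `U m` be a
`γ`-cover with shrinking `Z m`, and let `f m` agree with `d m` on `Z m` and with `g + 1` off `U m`;
then the `f m` are sequentially dense, and `K ⊆ U m` as soon as `f m` is close to `g` on `K`.

That sequentially dense sets can be selected from in place of sequences converging to `g` is
achieved by translation: a sequence converging to `g + c n`, moved back by the constant `c n`,
converges to `g`, and `c n → 0`.

By Velichko's theorem, property `V` is sequential separability of `C_p(X)`. If `V` holds, `X` maps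
injectively to the Hilbert cube so that continuous functions on `X` become `F_σ`-measurable, hence
pointwise limits of continuous functions on the cube, and these are separable in the uniform norm.
The limits come from convex selection: with the rational intervals and the closed pieces of their
preimages enumerated, a partition of unity provides a continuous `h m` with values in the first `m`
intervals on the corresponding pieces, shrunk so that pieces of disjoint intervals do not meet.
-/

section BaireOne

variable {X Z : Type*} [TopologicalSpace Z]

lemma exists_continuousMap_forall_mem_Icc [NormalSpace Z] [ParacompactSpace Z] {ι : Type*}
    [Finite ι] {C : ι → Set Z} (hC : ∀ i, IsClosed (C i)) {a b : ι → ℝ}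
    (hab : ∀ i j, (C i ∩ C j).Nonempty → a i ≤ b j) :
    ∃ h : C(Z, ℝ), ∀ i, ∀ z ∈ C i, h z ∈ Icc (a i) (b i) := by
  have common_value (z : Z) : ∃ c, ∀ i, z ∈ C i → c ∈ Icc (a i) (b i) := by
    rcases {i | z ∈ C i}.eq_empty_or_nonempty with hz | hz
    · exact ⟨0, fun i hi => (hz.subset hi).elim⟩
    · obtain ⟨i₀, hi₀, hmax⟩ := exists_max_image _ a (toFinite _) hz
      exact ⟨a i₀, fun i hi => ⟨hmax i hi, hab i₀ i ⟨z, hi₀, hi⟩⟩⟩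
  have eventually_imp (z : Z) : ∀ᶠ y in 𝓝 z, ∀ i, y ∈ C i → z ∈ C i := by
    refine eventually_all.2 fun i => ?_
    by_cases hz : z ∈ C i
    · exact Eventually.of_forall fun _ _ => hz
    · filter_upwards [(hC i).isOpen_compl.mem_nhds hz] with y hy hyC using absurd hyC hy
  obtain ⟨h, hh⟩ := exists_continuous_forall_mem_convex_of_local_const
    (t := fun z => ⋂ i, ⋂ _ : z ∈ C i, Icc (a i) (b i))
    (fun z => convex_iInter₂ fun i _ => convex_Icc (a i) (b i)) fun z => by
      obtain ⟨c, hc⟩ := common_value z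
      exact ⟨c, (eventually_imp z).mono fun y hy => mem_iInter₂.2 fun i hi => hc i (hy i hi)⟩
  exact ⟨h, fun i z hz => mem_iInter₂.1 (hh z) i hz⟩

lemma exists_seq_isClosed_disjoint [TopologicalSpace.MetrizableSpace Z] {C : ℕ → Set Z}
    (hC : ∀ i, IsClosed (C i)) {r : ℕ → ℕ → Prop} (hr : ∀ i j, r i j → r j i) :
    ∃ P : ℕ → ℕ → Set Z, (∀ m i, IsClosed (P m i)) ∧
      (∀ m i j, r i j → Disjoint (P m i) (P m j)) ∧
      ∀ i, ∀ z ∈ C i, (∀ j, r i j → z ∉ C j) → ∀ᶠ m in atTop, z ∈ P m i := by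
  let _ := TopologicalSpace.metrizableSpaceMetric Z
  -- Only the finitely many `j ≤ i` are avoided, so that no point is lost for infinitely many `m`.
  let P (m i : ℕ) : Set Z :=
    C i \ ⋃ j ∈ {j | j ≤ i ∧ r i j}, Metric.thickening (1 / ((m : ℝ) + 1)) (C j)
  have disjoint_of_le {m i j : ℕ} (hji : j ≤ i) (hij : r i j) : Disjoint (P m i) (P m j) :=
    disjoint_left.2 fun z hzi hzj => hzi.2 <| mem_biUnion ⟨hji, hij⟩ <|
      Metric.self_subset_thickening (by positivity) _ hzj.1
  refine ⟨P, fun m i => (hC i).sdiff (isOpen_biUnion fun _ _ => Metric.isOpen_thickening),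
    fun m i j hij => ?_, fun i z hz hzr => ?_⟩
  · rcases le_total j i with hji | hle
    exacts [disjoint_of_le hji hij, (disjoint_of_le hle (hr i j hij)).symm]
  · have avoids : ∀ j ∈ {j | j ≤ i ∧ r i j},
        ∀ᶠ m : ℕ in atTop, z ∉ Metric.thickening (1 / ((m : ℝ) + 1)) (C j) := fun j hj =>
      (tendsto_one_div_add_atTop_nhds_zero_nat (𝕜 := ℝ)).eventually <|
        Metric.eventually_notMem_thickening_of_infEDist_pos <| by
          rw [(hC j).closure_eq]
          exact hzr j hj.2
    filter_upwards [(eventually_all_finite ((finite_Iic i).subset fun j hj => hj.1)).2 avoids]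
      with m hm
    exact ⟨hz, fun hmem => by
      obtain ⟨j, hj, hzj⟩ := mem_iUnion₂.1 hmem
      exact hm j hj hzj⟩

lemma exists_seq_forall_eventually_mem_Icc [TopologicalSpace.MetrizableSpace Z] {C : ℕ → Set Z}
    (hC : ∀ i, IsClosed (C i)) {a b : ℕ → ℝ} {e : X → Z} {g : X → ℝ}
    (hg : ∀ i x, e x ∈ C i → g x ∈ Icc (a i) (b i)) :
    ∃ h : ℕ → C(Z, ℝ), ∀ i x, e x ∈ C i → ∀ᶠ m in atTop, h m (e x) ∈ Icc (a i) (b i) := by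
  let _ := TopologicalSpace.metrizableSpaceMetric Z
  obtain ⟨P, isClosed_P, disjoint_P, eventually_mem_P⟩ := exists_seq_isClosed_disjoint hC
    (r := fun i j => Disjoint (Icc (a i) (b i)) (Icc (a j) (b j))) fun _ _ h => h.symm
  have compatible (m i j : ℕ) (hne : (P m i ∩ P m j).Nonempty) : a i ≤ b j := by
    by_contra! hlt
    exact not_disjoint_iff_nonempty_inter.2 hne <| disjoint_P m i j <|
      disjoint_left.2 fun t hi hj => (hi.1.trans hj.2).not_gt hlt
  choose h hh using fun m => exists_continuousMap_forall_mem_Icc (ι := Iio m)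
    (fun i => isClosed_P m i) (fun i j => compatible m i j)
  refine ⟨h, fun i x hx => ?_⟩
  have hmem := eventually_mem_P i (e x) hx fun j hij hj =>
    disjoint_left.1 hij (hg i x hx) (hg j x hj)
  filter_upwards [hmem, eventually_gt_atTop i] with m hm him
  exact hh m ⟨i, him⟩ _ hm

/-- The **Lebesgue–Hausdorff theorem**, pulled back along `e`. -/
theorem exists_seq_tendsto_of_preimage_isFSigma [TopologicalSpace.MetrizableSpace Z] {e : X → Z}
    {g : X → ℝ} (hg : ∀ U : Set ℝ, IsOpen U → ∃ A : Set Z, IsFSigma A ∧ g ⁻¹' U = e ⁻¹' A) :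
    ∃ h : ℕ → C(Z, ℝ), ∀ x, Tendsto (fun m => h m (e x)) atTop (𝓝 (g x)) := by
  choose A hA hgA using fun p : ℚ × ℚ => hg (Ioo p.1 p.2) isOpen_Ioo
  choose C hC hAC using hA
  have mem_Ioo_iff (p : ℚ × ℚ) (x : X) : g x ∈ Ioo (p.1 : ℝ) p.2 ↔ ∃ j, e x ∈ C p j := by
    rw [← mem_iUnion, ← hAC, ← mem_preimage, hgA, mem_preimage]
  obtain ⟨φ, hφ⟩ := exists_surjective_nat ((ℚ × ℚ) × ℕ)
  obtain ⟨h, hh⟩ := exists_seq_forall_eventually_mem_Icc (fun i => hC (φ i).1 (φ i).2)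
    (fun i x hx => Ioo_subset_Icc_self ((mem_Ioo_iff (φ i).1 x).2 ⟨_, hx⟩))
  refine ⟨h, fun x => (nhds_basis_Ioo (g x)).tendsto_right_iff.2 ?_⟩
  rintro ⟨l, u⟩ ⟨hl, hu⟩
  obtain ⟨p, hlp, hp⟩ := exists_rat_btwn hl
  obtain ⟨q, hq, hqu⟩ := exists_rat_btwn hu
  obtain ⟨j, hj⟩ := (mem_Ioo_iff (p, q) x).1 ⟨hp, hq⟩
  obtain ⟨i, hi⟩ := hφ ((p, q), j)
  filter_upwards [hh i x (by rwa [hi])] with m hm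
  rw [hi] at hm
  exact ⟨hlp.trans_le hm.1, hm.2.trans_lt hqu⟩

theorem exists_countable_forall_exists_seq_tendsto [TopologicalSpace.MetrizableSpace Z]
    [CompactSpace Z] (e : X → Z) :
    ∃ D : Set C(Z, ℝ), D.Countable ∧ ∀ g : X → ℝ,
      (∀ U : Set ℝ, IsOpen U → ∃ A : Set Z, IsFSigma A ∧ g ⁻¹' U = e ⁻¹' A) →
      ∃ h : ℕ → C(Z, ℝ), (∀ m, h m ∈ D) ∧
        ∀ x, Tendsto (fun m => h m (e x)) atTop (𝓝 (g x)) := by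
  obtain ⟨D, hD, hdense⟩ := TopologicalSpace.exists_countable_dense C(Z, ℝ)
  refine ⟨D, hD, fun g hg => ?_⟩
  obtain ⟨h, hh⟩ := exists_seq_tendsto_of_preimage_isFSigma hg
  choose p hpD hp using fun m : ℕ =>
    hdense.exists_dist_lt (h m) (show (0 : ℝ) < 1 / ((m : ℝ) + 1) by positivity)
  refine ⟨p, hpD, fun x => (tendsto_iff_of_dist ?_).1 (hh x)⟩
  exact squeeze_zero (fun _ => dist_nonneg)
    (fun m => (ContinuousMap.dist_apply_le_dist (e x)).trans (hp m).le)
    tendsto_one_div_add_atTop_nhds_zero_nat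

end BaireOne

section ZeroSets

variable {X : Type*} [TopologicalSpace X]

lemma isZeroSet_preimage {M : Type*} [TopologicalSpace M] [TopologicalSpace.PseudoMetrizableSpace M]
    {h : X → M} (hh : Continuous h) {C : Set M} (hC : IsClosed C) : IsZeroSet (h ⁻¹' C) := by
  let _ := TopologicalSpace.pseudoMetrizableSpacePseudoMetric M
  rcases C.eq_empty_or_nonempty with rfl | hne
  · exact ⟨fun _ => 1, continuous_const, by simp⟩
  · refine ⟨fun x => Metric.infDist (h x) C, (Metric.continuous_infDist_pt C).comp hh, ?_⟩
    ext x
    exact hC.mem_iff_infDist_zero hne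

lemma isCozeroSet_preimage {M : Type*} [TopologicalSpace M]
    [TopologicalSpace.PseudoMetrizableSpace M] {h : X → M} (hh : Continuous h) {U : Set M}
    (hU : IsOpen U) : IsCozeroSet (h ⁻¹' U) :=
  isZeroSet_preimage hh hU.isClosed_compl

lemma IsCozeroSet.isOpen {U : Set X} (hU : IsCozeroSet U) : IsOpen U := by
  obtain ⟨f, hf, hfU⟩ := hU
  exact isClosed_compl_iff.1 (hfU ▸ isClosed_singleton.preimage hf)

lemma IsZeroSet.exists_continuous_eqOn_one_eqOn_zero {Z U : Set X} (hZ : IsZeroSet Z)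
    (hU : IsCozeroSet U) (hZU : Z ⊆ U) :
    ∃ φ : X → ℝ, Continuous φ ∧ EqOn φ 1 Z ∧ EqOn φ 0 Uᶜ := by
  obtain ⟨a, ha, rfl⟩ := hZ
  obtain ⟨b, hb, hbU⟩ := hU
  have hpos (x : X) : |a x| + |b x| ≠ 0 := by
    intro hx
    obtain ⟨hax, hbx⟩ := (add_eq_zero_iff_of_nonneg (abs_nonneg _) (abs_nonneg _)).1 hx
    exact (hbU.superset (abs_eq_zero.1 hbx)) (hZU (abs_eq_zero.1 hax))
  refine ⟨fun x => |b x| / (|a x| + |b x|), by fun_prop (disch := exact hpos _), ?_, ?_⟩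
  · intro x hx
    have hax : a x = 0 := hx
    have hbx := hpos x
    simp only [hax, abs_zero, zero_add] at hbx
    simp [hax, hbx]
  · intro x hx
    have hbx : b x = 0 := hbU.subset hx
    simp [hbx]

end ZeroSets

section Cp

variable {X : Type u} [TopologicalSpace X]

lemma Cp.tendsto_iff {ι : Type*} {l : Filter ι} {F : ι → Cp X} {g : Cp X} :
    Tendsto F l (𝓝 g) ↔ ∀ x, Tendsto (fun i => (F i).1 x) l (𝓝 (g.1 x)) := by
  rw [tendsto_subtype_rng, tendsto_pi_nhds]

lemma Cp.eventually_abs_sub_lt (g : Cp X) {K : Set X} (hK : K.Finite) {ε : ℝ} (hε : 0 < ε) :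
    ∀ᶠ f in 𝓝 g, ∀ x ∈ K, |f.1 x - g.1 x| < ε :=
  (eventually_all_finite hK).2 fun x _ =>
    (Cp.tendsto_iff.1 tendsto_id x).eventually (Metric.ball_mem_nhds _ hε)

lemma Cp.hasBasis_nhds (g : Cp X) :
    (𝓝 g).HasBasis (fun p : Set X × ℝ => p.1.Finite ∧ 0 < p.2)
      (fun p => {f | ∀ x ∈ p.1, |f.1 x - g.1 x| < p.2}) := by
  refine ⟨fun S => ⟨fun hS => ?_, fun ⟨p, ⟨hK, hε⟩, hS⟩ =>
    mem_of_superset (Cp.eventually_abs_sub_lt g hK hε) hS⟩⟩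
  rw [nhds_subtype_eq_comap, mem_comap] at hS
  obtain ⟨V, hV, hVS⟩ := hS
  rw [nhds_pi, Filter.mem_pi] at hV
  obtain ⟨K, hK, t, ht, htV⟩ := hV
  have eventually_ball_subset : ∀ᶠ ε : ℝ in 𝓝[>] 0, ∀ x ∈ K, Metric.ball (g.1 x) ε ⊆ t x := by
    refine (eventually_all_finite hK).2 fun x _ => ?_
    obtain ⟨δ, hδ, hδt⟩ := Metric.mem_nhds_iff.1 (ht x)
    filter_upwards [Ioo_mem_nhdsGT hδ] with ε hε
    exact (Metric.ball_subset_ball hε.2.le).trans hδt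
  obtain ⟨ε, hεt, hε⟩ := (eventually_ball_subset.and self_mem_nhdsWithin).exists
  exact ⟨(K, ε), ⟨hK, hε⟩, fun f hf => hVS (htV fun x hx => hεt x hx (hf x hx))⟩

/-- Translation of continuous functions by real constants. Moving a point `g` of `C_p(X)` along
this action gives a nontrivial sequence converging to `g`. -/
instance Cp.instAddAction : AddAction ℝ (Cp X) where
  vadd c f := ⟨fun x => c + f.1 x, continuous_const.add f.2⟩
  zero_vadd f := Subtype.ext (funext fun x => zero_add (f.1 x))
  add_vadd c d f := Subtype.ext (funext fun x => add_assoc c d (f.1 x))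

instance Cp.instContinuousVAdd : ContinuousVAdd ℝ (Cp X) where
  continuous_vadd := Continuous.subtype_mk (continuous_pi fun x =>
    continuous_fst.add ((continuous_apply x).comp (continuous_subtype_val.comp continuous_snd))) _

lemma Cp.vadd_apply (c : ℝ) (f : Cp X) (x : X) : (c +ᵥ f).1 x = c + f.1 x := rfl

lemma Cp.vadd_ne [Nonempty X] (g : Cp X) {c : ℝ} (hc : c ≠ 0) : c +ᵥ g ≠ g := fun h =>
  hc (add_eq_right.1 (congrFun (congrArg Subtype.val h) (Classical.arbitrary X)))

lemma Cp.nhdsNE_neBot [Nonempty X] (g : Cp X) : (𝓝[≠] g).NeBot := by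
  have tendsto_vadd : Tendsto (fun n : ℕ => (1 / ((n : ℝ) + 1)) +ᵥ g) atTop (𝓝 g) := by
    simpa only [zero_vadd] using
      (tendsto_one_div_add_atTop_nhds_zero_nat (𝕜 := ℝ)).vadd_const g
  exact mem_closure_iff_nhdsWithin_neBot.1 <| mem_closure_of_tendsto tendsto_vadd <|
    Eventually.of_forall fun n => Cp.vadd_ne g (by positivity)

end Cp

section SequentialSeparability

lemma SeqSeparable.exists_seq {Z : Type*} [TopologicalSpace Z] [Nonempty Z] (h : SeqSeparable Z) :
    ∃ d : ℕ → Z, ∀ z, ∃ k : ℕ → ℕ, Tendsto k atTop atTop ∧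
      Tendsto (fun j => d (k j)) atTop (𝓝 z) := by
  obtain ⟨D, hD, hseq⟩ := h
  have exists_tendsto (z : Z) : ∃ u : ℕ → Z, (∀ j, u j ∈ D) ∧ Tendsto u atTop (𝓝 z) :=
    eq_univ_iff_forall.1 hseq z
  obtain ⟨u, hu, -⟩ := exists_tendsto (Classical.arbitrary Z)
  obtain ⟨d, rfl⟩ := hD.exists_eq_range ⟨u 0, hu 0⟩
  -- Each point of `D` is listed infinitely often, so that the indices `k` can tend to infinity.
  refine ⟨fun m => d m.unpair.1, fun z => ?_⟩
  obtain ⟨v, hv, hlim⟩ := exists_tendsto z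
  choose i hi using hv
  refine ⟨fun j => Nat.pair (i j) j,
    tendsto_atTop_mono (fun j => Nat.right_le_pair _ _) tendsto_id, ?_⟩
  simpa only [Nat.unpair_pair, hi] using hlim

lemma IsFSigma.preimage {Y Z : Type*} [TopologicalSpace Y] [TopologicalSpace Z] {A : Set Z}
    (hA : IsFSigma A) {p : Y → Z} (hp : Continuous p) : IsFSigma (p ⁻¹' A) := by
  obtain ⟨C, hC, rfl⟩ := hA
  exact ⟨fun n => p ⁻¹' C n, fun n => (hC n).preimage hp, preimage_iUnion⟩

lemma exists_isFSigma_setOf_ne_zero_eq_preimage {X Z : Type*} [TopologicalSpace Z] {u : ℕ → Z → ℝ}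
    (hu : ∀ j, Continuous (u j)) {e : X → Z} {g : X → ℝ}
    (hug : ∀ x, Tendsto (fun j => u j (e x)) atTop (𝓝 (g x))) :
    ∃ A, IsFSigma A ∧ {x | g x ≠ 0} = e ⁻¹' A := by
  let C (i : ℕ) : Set Z := {z | ∀ j ≥ i.unpair.1, 1 / ((i.unpair.2 : ℝ) + 1) ≤ |u j z|}
  have isClosed_C (i : ℕ) : IsClosed (C i) := by
    simp only [C, ofPred_forall]
    exact isClosed_iInter fun j => isClosed_iInter fun _ => isClosed_le continuous_const (hu j).abs
  refine ⟨⋃ i, C i, ⟨C, isClosed_C, rfl⟩, ?_⟩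
  ext x
  rw [mem_preimage, mem_iUnion]
  constructor
  · intro hx
    obtain ⟨m, hm⟩ := exists_nat_one_div_lt (abs_pos.2 hx)
    obtain ⟨N, hN⟩ := eventually_atTop.1 ((hug x).abs.eventually (lt_mem_nhds hm))
    refine ⟨Nat.pair N m, fun j hj => ?_⟩
    rw [Nat.unpair_pair] at hj ⊢
    exact (hN j hj).le
  · rintro ⟨i, hi⟩
    have hle : 1 / ((i.unpair.2 : ℝ) + 1) ≤ |g x| :=
      ge_of_tendsto (hug x).abs (eventually_atTop.2 ⟨_, hi⟩)
    exact abs_pos.1 (lt_of_lt_of_le (by positivity) hle)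

variable {X : Type u} [TopologicalSpace X]

theorem PropertyV.seqSeparable (h : PropertyV X) : SeqSeparable (Cp X) := by
  obtain ⟨Y, _, _, f, hf, hbij, hU⟩ := h
  obtain ⟨F, hF⟩ := Metric.PiNatEmbed.exists_embedding_to_hilbert_cube (X := Y)
  have hFf : Continuous (F ∘ f) := hF.continuous.comp hf
  obtain ⟨D, hD, hlim⟩ := exists_countable_forall_exists_seq_tendsto (F ∘ f)
  have preimage_eq (g : Cp X) (U : Set ℝ) (hUo : IsOpen U) :
      ∃ A, IsFSigma A ∧ g.1 ⁻¹' U = F ∘ f ⁻¹' A := by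
    obtain ⟨C, hC, hCU⟩ := hU _ (isCozeroSet_preimage g.2 hUo)
    choose T hT hTC using fun n => hF.isInducing.isClosed_iff.1 (hC n)
    refine ⟨⋃ n, T n, ⟨T, hT, rfl⟩, ?_⟩
    rw [preimage_comp, preimage_iUnion, iUnion_congr hTC, ← hCU, hbij.1.preimage_image]
  refine ⟨(fun h : C(ℕ → unitInterval, ℝ) => ⟨h ∘ F ∘ f, h.continuous.comp hFf⟩) '' D,
    hD.image _, eq_univ_of_forall fun g => ?_⟩
  obtain ⟨h, hhD, hh⟩ := hlim g.1 (preimage_eq g)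
  exact ⟨_, fun m => mem_image_of_mem _ (hhD m), Cp.tendsto_iff.2 hh⟩

lemma propertyV_of_forall_isFSigma_preimage {M : Type u} [MetricSpace M]
    [SecondCountableTopology M] {e : X → M} (he : Continuous e) (hinj : Function.Injective e)
    (hU : ∀ U : Set X, IsCozeroSet U → ∃ A, IsFSigma A ∧ U = e ⁻¹' A) : PropertyV X := by
  refine ⟨range e, inferInstance, inferInstance, rangeFactorization e, he.rangeFactorization,
    ⟨rangeFactorization_injective.2 hinj, rangeFactorization_surjective⟩, fun U hUc => ?_⟩
  obtain ⟨A, hA, rfl⟩ := hU U hUc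
  have image_eq : rangeFactorization e '' (e ⁻¹' A) = Subtype.val ⁻¹' A :=
    image_preimage_eq (Subtype.val ⁻¹' A) rangeFactorization_surjective
  exact image_eq ▸ hA.preimage continuous_subtype_val

theorem SeqSeparable.propertyV (h : SeqSeparable (Cp X))
    (hX : {f : X → ℝ | Continuous f}.SeparatesPoints) : PropertyV X := by
  have : Nonempty (Cp X) := ⟨⟨fun _ => 0, continuous_const⟩⟩
  obtain ⟨d, hd⟩ := h.exists_seq
  -- `ULift` only serves to place the target in the universe of `X`.
  let e : X → ULift.{u} ℕ → ℝ := fun x k => (d k.down).1 x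
  have injective_e : Function.Injective e := by
    intro x y hxy
    by_contra hne
    obtain ⟨f, hf, hfxy⟩ := hX hne
    obtain ⟨k, -, hk⟩ := hd ⟨f, hf⟩
    refine hfxy (tendsto_nhds_unique (Cp.tendsto_iff.1 hk x) ?_)
    have d_apply_eq (i : ℕ) : (d i).1 x = (d i).1 y := congrFun hxy ⟨i⟩
    simpa only [d_apply_eq] using Cp.tendsto_iff.1 hk y
  let _ := TopologicalSpace.metrizableSpaceMetric (ULift.{u} ℕ → ℝ)
  refine propertyV_of_forall_isFSigma_preimage (e := e)
    (continuous_pi fun k => (d k.down).2) injective_e ?_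
  rintro U ⟨g, hg, hgU⟩
  obtain ⟨k, -, hk⟩ := hd ⟨g, hg⟩
  rw [show U = {x | g x ≠ 0} from compl_injective (by rw [hgU]; ext x; simp)]
  exact exists_isFSigma_setOf_ne_zero_eq_preimage (fun j => continuous_apply ⟨k j⟩)
    (Cp.tendsto_iff.1 hk)

end SequentialSeparability
section SelectionPrinciples

variable {α : Type u} {l : Filter α} {𝒜 ℬ : Set (Set α)}

/-- The sets `A` that accumulate at the filter `l` without containing a point lying in every member
of `l`. The sets in `Ω_x` accumulate at `𝓝 x` in this way, and the `ω`-covers at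
`omegaFilter X`. -/
def AccumulatingAt (l : Filter α) : Set (Set α) :=
  {A | (∃ᶠ a in l, a ∈ A) ∧ ∀ a ∈ A, ∀ᶠ b in l, b ≠ a}

lemma exists_seq_tendsto_of_forall_finite_sdiff {A : Set α} (hA : A.Infinite)
    (h : ∀ S ∈ l, (A \ S).Finite) : ∃ s : ℕ → α, (∀ i, s i ∈ A) ∧ Tendsto s atTop l := by
  refine ⟨fun i => hA.natEmbedding A i, fun i => (hA.natEmbedding A i).2, fun S hS => ?_⟩
  rw [← Nat.cofinite_eq_atTop, mem_map, mem_cofinite]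
  exact ((h S hS).preimage (Subtype.val_injective.comp (hA.natEmbedding A).injective).injOn).subset
    fun i hi => ⟨(hA.natEmbedding A i).2, hi⟩

lemma AccumulatingAt.frequently_inter_nonempty {B : ℕ → Set α} (hfin : ∀ n, (B n).Finite)
    (hB : (⋃ n, B n) ∈ AccumulatingAt l) {S : Set α} (hS : S ∈ l) :
    ∃ᶠ n in atTop, (B n ∩ S).Nonempty := by
  refine frequently_atTop.2 fun N => ?_
  have avoids_early : ∀ᶠ b in l, ∀ n ∈ Iio N, ∀ a ∈ B n, b ≠ a :=
    (eventually_all_finite (finite_Iio N)).2 fun n _ => (eventually_all_finite (hfin n)).2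
      fun a ha => hB.2 a (mem_iUnion_of_mem n ha)
  obtain ⟨b, hb, hbS, havoid⟩ :=
    (hB.1.and_eventually ((show ∀ᶠ b in l, b ∈ S from hS).and avoids_early)).exists
  obtain ⟨n, hn⟩ := mem_iUnion.1 hb
  exact ⟨n, not_lt.1 fun hlt => havoid n hlt b hn rfl, b, hn, hbS⟩

lemma SelFin.exists_finset_frequently (h : SelFin 𝒜 ℬ) (hℬ : ℬ ⊆ AccumulatingAt l) {ι : Type*}
    {s : ℕ → ι → α} (hs : ∀ n, range (s n) ∈ 𝒜 ∨ ∃ i, pure (s n i) ≤ l) :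
    ∃ F : ℕ → Finset ι, ∀ S ∈ l, ∃ᶠ n in atTop, ∃ i ∈ F n, s n i ∈ S := by
  classical
  by_cases h_all : ∀ n, ∃ i, pure (s n i) ≤ l
  · choose i hi using h_all
    exact ⟨fun n => {i n}, fun S hS => Frequently.of_forall fun n =>
      ⟨i n, Finset.mem_singleton_self _, hi n hS⟩⟩
  obtain ⟨n₀, hn₀⟩ := not_forall.1 h_all
  -- The stages at which the choice is trivial are filled up with the family of stage `n₀`.
  obtain ⟨B, hB, hBℬ⟩ := h (fun n => if range (s n) ∈ 𝒜 then range (s n) else range (s n₀))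
    fun n => by
      split_ifs with hn
      exacts [hn, (hs n₀).resolve_right hn₀]
  have meets_if (n : ℕ) : ∃ F : Finset ι, ∀ S ∈ l, (B n ∩ S).Nonempty → ∃ i ∈ F, s n i ∈ S := by
    rcases hs n with hn | ⟨i, hi⟩
    · have hBn : ↑(hB n).1.toFinset ⊆ s n '' univ := by
        simpa only [Finite.coe_toFinset, image_univ, if_pos hn] using (hB n).2
      obtain ⟨F, -, hF⟩ := Finset.subset_set_image_iff.1 hBn
      refine ⟨F, fun S _ ⟨b, hb, hbS⟩ => ?_⟩
      obtain ⟨i, hi, rfl⟩ := Finset.mem_image.1 (hF ▸ (hB n).1.mem_toFinset.2 hb)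
      exact ⟨i, hi, hbS⟩
    · exact ⟨{i}, fun S hS _ => ⟨i, Finset.mem_singleton_self i, hi hS⟩⟩
  choose F hF using meets_if
  exact ⟨F, fun S hS => (AccumulatingAt.frequently_inter_nonempty (fun n => (hB n).1)
    (hℬ hBℬ) hS).mono fun n => hF n S hS⟩

/-- The form of `S_fin(Γ_x, Ω_x)` in which the members of `Γ_x` are replaced by sequences converging
along `l = 𝓝 x`: finitely many terms can be chosen from each sequence so that every member of `l`
contains chosen terms of infinitely many of them. -/
def SeqSelFin (l : Filter α) : Prop :=
  ∀ s : ℕ → ℕ → α, (∀ n, Tendsto (s n) atTop l) →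
    ∃ F : ℕ → Finset ℕ, ∀ S ∈ l, ∃ᶠ n in atTop, ∃ i ∈ F n, s n i ∈ S

end SelectionPrinciples

section PointSelection

variable {Z : Type u} [TopologicalSpace Z]

lemma omegaAt_subset_accumulatingAt [T1Space Z] (z : Z) : OmegaAt z ⊆ AccumulatingAt (𝓝 z) :=
  fun _ hA => ⟨mem_closure_iff_frequently.1 hA.1,
    fun _ ha => isOpen_ne.mem_nhds fun hza => hA.2 (hza ▸ ha)⟩

lemma range_mem_gammaAt [T1Space Z] {s : ℕ → Z} {z : Z} (hs : Tendsto s atTop (𝓝 z))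
    (hne : ∀ i, s i ≠ z) : range s ∈ GammaAt z := by
  have hz : z ∉ range s := fun ⟨i, hi⟩ => hne i hi
  refine ⟨fun hfin => hz ?_, hz, fun U hU => ?_⟩
  · rw [← hfin.isClosed.closure_eq]
    exact mem_closure_of_tendsto hs (Eventually.of_forall mem_range_self)
  · rw [← Nat.cofinite_eq_atTop] at hs
    refine ((hs hU).image s).subset ?_
    rintro _ ⟨⟨i, rfl⟩, hi⟩
    exact ⟨i, hi, rfl⟩

theorem SeqSelFin.selFin_gammaAt_omegaAt {z : Z} (h : SeqSelFin (𝓝 z)) :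
    SelFin (GammaAt z) (OmegaAt z) := by
  intro A hA
  choose s hsA hs using fun n => exists_seq_tendsto_of_forall_finite_sdiff (hA n).1 (hA n).2.2
  obtain ⟨F, hF⟩ := h s hs
  refine ⟨fun n => s n '' F n, fun n => ⟨(F n).finite_toSet.image _,
    image_subset_iff.2 fun i _ => hsA n i⟩, mem_closure_iff_nhds.2 fun U hU => ?_, fun hz => ?_⟩
  · obtain ⟨n, i, hi, hiU⟩ := (hF U hU).exists
    exact ⟨s n i, hiU, mem_iUnion.2 ⟨n, mem_image_of_mem _ hi⟩⟩
  · obtain ⟨n, i, -, hi⟩ := mem_iUnion.1 hz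
    exact (hA n).2.1 (hi ▸ hsA n i)

theorem seqSelFin_nhds_of_selFin_gammaAt_omegaAt [T1Space Z] {z : Z}
    (h : SelFin (GammaAt z) (OmegaAt z)) : SeqSelFin (𝓝 z) := by
  refine fun s hs => h.exists_finset_frequently (omegaAt_subset_accumulatingAt z) fun n => ?_
  by_cases hn : ∀ i, s n i ≠ z
  · exact Or.inl (range_mem_gammaAt (hs n) hn)
  · obtain ⟨i, hi⟩ := not_forall_not.1 hn
    exact Or.inr ⟨i, hi ▸ pure_le_nhds (s n i)⟩

theorem SeqSelFin.selFin_seqDenseSets_omegaAt {G : Type*} [AddGroup G] [TopologicalSpace G]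
    [AddAction G Z] [ContinuousVAdd G Z] [T1Space Z] {c : ℕ → G} (hc : Tendsto c atTop (𝓝 0))
    {z : Z} (hcz : ∀ n, c n +ᵥ z ≠ z) (h : SeqSelFin (𝓝 z)) :
    SelFin (SeqDenseSets Z) (OmegaAt z) := by
  intro A hA
  -- Aiming at `c n +ᵥ z` instead of `z` keeps the points chosen from `A n` away from `z`.
  have exists_seq (n : ℕ) : ∃ a : ℕ → Z,
      (∀ i, a i ∈ A n ∧ a i ≠ z) ∧ Tendsto a atTop (𝓝 (c n +ᵥ z)) := by
    obtain ⟨a, haA, ha⟩ := eq_univ_iff_forall.1 (hA n) (c n +ᵥ z)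
    obtain ⟨N, hN⟩ := eventually_atTop.1 (ha.eventually_ne (hcz n))
    exact ⟨fun i => a (i + N), fun i => ⟨haA _, hN _ (Nat.le_add_left N i)⟩,
      ha.comp (tendsto_add_atTop_nat N)⟩
  choose a haA ha using exists_seq
  obtain ⟨F, hF⟩ := h (fun n i => -c n +ᵥ a n i) fun n => by
    simpa only [neg_vadd_vadd] using (ha n).const_vadd (-c n)
  refine ⟨fun n => a n '' F n, fun n => ⟨(F n).finite_toSet.image _,
    image_subset_iff.2 fun i _ => (haA n i).1⟩, mem_closure_iff_nhds.2 fun W hW => ?_, fun hz => ?_⟩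
  · have vadd_mem : ∀ᶠ p : G × Z in 𝓝 0 ×ˢ 𝓝 z, p.1 +ᵥ p.2 ∈ W := by
      rw [← nhds_prod_eq]
      refine continuous_vadd.continuousAt.eventually_mem ?_
      simpa only [zero_vadd] using hW
    obtain ⟨V, hV, S, hS, hVS⟩ := eventually_prod_iff.1 vadd_mem
    obtain ⟨n, ⟨i, hi, hS⟩, hcV⟩ := ((hF _ hS).and_eventually (hc.eventually hV)).exists
    refine ⟨a n i, ?_, mem_iUnion.2 ⟨n, mem_image_of_mem _ hi⟩⟩
    simpa only [vadd_neg_vadd] using hVS hcV hS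
  · obtain ⟨n, i, -, hi⟩ := mem_iUnion.1 hz
    exact (haA n i).2 hi

theorem selFin_denseSets_of_forall_omegaAt [Nonempty Z] (hsep : SeqSeparable Z)
    {𝒜 : Set (Set Z)} (h : ∀ z : Z, SelFin 𝒜 (OmegaAt z)) : SelFin 𝒜 (DenseSets Z) := by
  intro A hA
  obtain ⟨d, hd⟩ := hsep.exists_seq
  have dense_range : Dense (range d) := fun z => by
    obtain ⟨k, -, hk⟩ := hd z
    exact mem_closure_of_tendsto hk (Eventually.of_forall fun j => mem_range_self _)
  choose B hB hBω using fun k => h (d k) (fun n => A (Nat.pair k n)) fun n => hA _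
  refine ⟨fun m => B m.unpair.1 m.unpair.2, fun m => ?_, ?_⟩
  · simpa only [Nat.pair_unpair] using hB m.unpair.1 m.unpair.2
  · refine Dense.of_closure (dense_range.mono ?_)
    rintro _ ⟨k, rfl⟩
    refine closure_mono (iUnion_subset fun n => ?_) (hBω k).1
    refine subset_iUnion_of_subset (Nat.pair k n) ?_
    rw [Nat.unpair_pair]

theorem SelFin.omegaAt_of_denseSets [T1Space Z] {𝒜 : Set (Set Z)} {z : Z} [(𝓝[≠] z).NeBot]
    (h : SelFin 𝒜 (DenseSets Z)) : SelFin 𝒜 (OmegaAt z) := by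
  intro A hA
  obtain ⟨B, hB, hdense⟩ := h A hA
  refine ⟨fun n => B n \ {z},
    fun n => ⟨(hB n).1.subset sdiff_subset, sdiff_subset.trans (hB n).2⟩, ?_⟩
  rw [← iUnion_sdiff]
  exact ⟨Dense.sdiff_singleton hdense z z, fun hz => hz.2 rfl⟩

end PointSelection
section OmegaFilter

/-- The filter on the subsets of `X` generated by the families `{U | K ⊆ U}` with `K` finite. A
`γ`-cover is a sequence of subsets converging along this filter, and an `ω`-cover accumulates at
it. -/
def omegaFilter (X : Type*) : Filter (Set X) := ⨅ x, 𝓟 {U | x ∈ U}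

variable {X : Type*}

lemma hasBasis_omegaFilter : (omegaFilter X).HasBasis Set.Finite fun K => {U | K ⊆ U} :=
  (hasBasis_iInf_principal_finite fun x : X => {U : Set X | x ∈ U}).to_hasBasis
    (fun K hK => ⟨K, hK, fun _ hU => mem_iInter₂.2 fun _ hx => hU hx⟩)
    (fun K hK => ⟨K, hK, fun _ hU x hx => mem_iInter₂.1 hU x hx⟩)

lemma setOf_mem_mem_omegaFilter (x : X) : {U : Set X | x ∈ U} ∈ omegaFilter X :=
  mem_iInf_of_mem x (mem_principal_self _)

lemma pure_univ_le_omegaFilter : pure univ ≤ omegaFilter X :=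
  le_iInf fun x => le_principal_iff.2 (mem_univ x)

lemma tendsto_omegaFilter_iff {ι : Type*} {l : Filter ι} {U : ι → Set X} :
    Tendsto U l (omegaFilter X) ↔ ∀ x, ∀ᶠ i in l, x ∈ U i := by
  simp only [omegaFilter, tendsto_iInf, tendsto_principal, mem_ofPred_eq]

lemma isGammaCover_range {ι : Type*} [Infinite ι] {U : ι → Set X} (hU : ∀ i, U i ≠ univ)
    (h : Tendsto U cofinite (omegaFilter X)) : IsGammaCover (range U) := by
  rw [tendsto_omegaFilter_iff] at h
  refine ⟨⟨eq_univ_of_forall fun x => ?_, fun ⟨i, hi⟩ => hU i hi⟩, fun hfin => ?_, fun x => ?_⟩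
  · obtain ⟨i, hi⟩ := (h x).exists
    exact ⟨U i, mem_range_self i, hi⟩
  · have := hfin.to_subtype
    obtain ⟨⟨_, i, rfl⟩, hi⟩ := Finite.exists_infinite_fiber (rangeFactorization U)
    obtain ⟨x, hx⟩ := (ne_univ_iff_exists_notMem _).1 (hU i)
    refine (infinite_coe_iff.1 hi) ((eventually_cofinite.1 (h x)).subset fun j hj => ?_)
    rwa [mem_ofPred_eq, show U j = U i from congrArg Subtype.val hj]
  · refine ((eventually_cofinite.1 (h x)).image U).subset ?_
    rintro _ ⟨⟨i, rfl⟩, hi⟩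
    exact ⟨i, hi, rfl⟩

lemma IsGammaCover.finite_sdiff {𝒰 : Set (Set X)} (h : IsGammaCover 𝒰) {S : Set (Set X)}
    (hS : S ∈ omegaFilter X) : (𝒰 \ S).Finite := by
  have cofinite_inf_le : cofinite ⊓ 𝓟 𝒰 ≤ omegaFilter X := le_iInf fun x =>
    le_principal_iff.2 <| mem_inf_principal.2 <| (h.2.2 x).subset fun U hU => by
      simpa using hU
  exact (mem_inf_principal.1 (cofinite_inf_le hS)).subset fun U hU => by simpa using hU

end OmegaFilter

section CoverSelection

variable {X : Type u} [TopologicalSpace X]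

lemma openOmegaCovers_subset_accumulatingAt :
    OpenOmegaCovers X ⊆ AccumulatingAt (omegaFilter X) := by
  refine fun 𝒰 h𝒰 => ⟨hasBasis_omegaFilter.frequently_iff.2 fun {K} hK => ?_, fun U hU => ?_⟩
  · obtain ⟨U, hU, hKU⟩ := h𝒰.2.2 K hK
    exact ⟨U, hKU, hU⟩
  · obtain ⟨x, hx⟩ := (ne_univ_iff_exists_notMem U).1 fun h => h𝒰.2.1.2 (h ▸ hU)
    filter_upwards [setOf_mem_mem_omegaFilter x] with V hV hVU using hx (hVU ▸ hV)

lemma range_mem_shrinkableGammaCovers {ι : Type*} [Infinite ι] {U Z : ι → Set X}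
    (hU : ∀ i, IsCozeroSet (U i)) (hZ : ∀ i, IsZeroSet (Z i)) (hZU : ∀ i, Z i ⊆ U i)
    (hne : ∀ i, U i ≠ univ) (hlim : Tendsto Z cofinite (omegaFilter X)) :
    range U ∈ ShrinkableGammaCovers X := by
  have isGammaCover_U : IsGammaCover (range U) := isGammaCover_range hne <|
    tendsto_omegaFilter_iff.2 fun x => (tendsto_omegaFilter_iff.1 hlim x).mono fun i hi => hZU i hi
  choose! index index_spec using fun V (hV : V ∈ range U) => hV
  have subset_self {V : Set X} (hV : V ∈ range U) : Z (index V) ⊆ V :=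
    (hZU _).trans (index_spec V hV).subset
  refine ⟨forall_mem_range.2 hU, isGammaCover_U, fun V => Z (index V),
    fun V hV => ⟨hZ _, subset_self hV⟩, ?_⟩
  have : Infinite (range U) := isGammaCover_U.2.1.to_subtype
  have index_injective : Function.Injective fun V : range U => index V := fun V W hVW =>
    Subtype.ext <| by rw [← index_spec V V.2, ← index_spec W W.2, show index V = index W from hVW]
  rw [image_eq_range]
  refine isGammaCover_range (fun V hV => hne (index V) ?_)
    (hlim.comp index_injective.tendsto_cofinite)
  exact univ_subset_iff.1 (hV ▸ hZU _)

lemma exists_seq_of_mem_shrinkableGammaCovers {𝒰 : Set (Set X)} (h : 𝒰 ∈ ShrinkableGammaCovers X) :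
    ∃ U Z : ℕ → Set X, (∀ m, U m ∈ 𝒰) ∧ (∀ m, IsZeroSet (Z m)) ∧ (∀ m, Z m ⊆ U m) ∧
      Tendsto Z atTop (omegaFilter X) := by
  obtain ⟨-, -, F, hF, hγ⟩ := h
  obtain ⟨Z, hZF, hZ⟩ :=
    exists_seq_tendsto_of_forall_finite_sdiff hγ.2.1 fun S hS => hγ.finite_sdiff hS
  choose U hU hUZ using hZF
  exact ⟨U, Z, hU, fun m => hUZ m ▸ (hF _ (hU m)).1, fun m => hUZ m ▸ (hF _ (hU m)).2, hZ⟩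

lemma range_setOf_abs_sub_lt_mem_shrinkableGammaCovers {ι : Type*} [Infinite ι] {s : ι → Cp X}
    {g : Cp X} (hs : Tendsto s cofinite (𝓝 g)) {ε : ℝ} (hε : 0 < ε)
    (hne : ∀ i, {x | |(s i).1 x - g.1 x| < ε} ≠ univ) :
    range (fun i => {x | |(s i).1 x - g.1 x| < ε}) ∈ ShrinkableGammaCovers X := by
  have continuous_dist (i : ι) : Continuous fun x => |(s i).1 x - g.1 x| :=
    ((s i).2.sub g.2).abs
  refine range_mem_shrinkableGammaCovers (Z := fun i => {x | |(s i).1 x - g.1 x| ≤ ε / 2})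
    (fun i => isCozeroSet_preimage (continuous_dist i) isOpen_Iio)
    (fun i => isZeroSet_preimage (continuous_dist i) isClosed_Iic)
    (fun i x hx => lt_of_le_of_lt hx (half_lt_self hε)) hne
    (tendsto_omegaFilter_iff.2 fun x => ?_)
  filter_upwards [hs.eventually (Cp.eventually_abs_sub_lt g (finite_singleton x) (half_pos hε))]
    with i hi using (hi x rfl).le

theorem SelFin.seqSelFin_nhds_of_covers
    (h : SelFin (ShrinkableGammaCovers X) (OpenOmegaCovers X)) (g : Cp X) : SeqSelFin (𝓝 g) := by
  intro s hs
  let U (n i : ℕ) : Set X := {x | |(s n i).1 x - g.1 x| < 1 / ((n : ℝ) + 1)}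
  obtain ⟨F, hF⟩ := h.exists_finset_frequently openOmegaCovers_subset_accumulatingAt (s := U)
    fun n => by
      by_cases hn : ∀ i, U n i ≠ univ
      · exact Or.inl <| range_setOf_abs_sub_lt_mem_shrinkableGammaCovers
          (Nat.cofinite_eq_atTop ▸ hs n) (by positivity) hn
      · obtain ⟨i, hi⟩ := not_forall_not.1 hn
        exact Or.inr ⟨i, hi ▸ pure_univ_le_omegaFilter⟩
  refine ⟨F, fun S hS => ?_⟩
  obtain ⟨⟨K, ε⟩, ⟨hK, hε⟩, hKS⟩ := (Cp.hasBasis_nhds g).mem_iff.1 hS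
  have eventually_lt := tendsto_one_div_add_atTop_nhds_zero_nat.eventually (gt_mem_nhds hε)
  refine ((hF _ (hasBasis_omegaFilter.mem_of_mem hK)).and_eventually eventually_lt).mono ?_
  rintro n ⟨⟨i, hi, hKi⟩, hn⟩
  exact ⟨i, hi, hKS fun x hx => (hKi hx).trans hn⟩

lemma IsZeroSet.exists_cp_eqOn_eqOn {Z U : Set X} (hZ : IsZeroSet Z) (hU : IsCozeroSet U)
    (hZU : Z ⊆ U) (f g : Cp X) : ∃ h : Cp X, EqOn h.1 f.1 Z ∧ EqOn h.1 g.1 Uᶜ := by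
  obtain ⟨φ, hφ, hφZ, hφU⟩ := hZ.exists_continuous_eqOn_one_eqOn_zero hU hZU
  refine ⟨⟨fun x => φ x * f.1 x + (1 - φ x) * g.1 x,
    (hφ.mul f.2).add ((continuous_const.sub hφ).mul g.2)⟩, fun x hx => ?_, fun x hx => ?_⟩
  · simp [hφZ hx]
  · simp [hφU hx]

lemma range_mem_seqDenseSets_of_eqOn {d : ℕ → Cp X}
    (hd : ∀ g, ∃ k : ℕ → ℕ, Tendsto k atTop atTop ∧ Tendsto (fun j => d (k j)) atTop (𝓝 g))
    {Z : ℕ → Set X} (hZ : Tendsto Z atTop (omegaFilter X)) {f : ℕ → Cp X}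
    (hf : ∀ m, EqOn (f m).1 (d m).1 (Z m)) : range f ∈ SeqDenseSets (Cp X) := by
  refine eq_univ_of_forall fun g => ?_
  obtain ⟨k, hk, hlim⟩ := hd g
  refine ⟨fun j => f (k j), fun j => mem_range_self _, Cp.tendsto_iff.2 fun x => ?_⟩
  refine (Cp.tendsto_iff.1 hlim x).congr' ?_
  filter_upwards [hk.eventually (tendsto_omegaFilter_iff.1 hZ x)] with j hj
  exact (hf (k j) hj).symm

lemma mem_openOmegaCovers_of_forall_finite {𝒱 : Set (Set X)} (hopen : ∀ V ∈ 𝒱, IsOpen V)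
    (hne : univ ∉ 𝒱) (h : ∀ K : Set X, K.Finite → ∃ V ∈ 𝒱, K ⊆ V) : 𝒱 ∈ OpenOmegaCovers X := by
  refine ⟨hopen, ⟨eq_univ_of_forall fun x => ?_, hne⟩, h⟩
  obtain ⟨V, hV, hxV⟩ := h {x} (finite_singleton x)
  exact ⟨V, hV, hxV rfl⟩

theorem SeqSeparable.selFin_covers (hsep : SeqSeparable (Cp X)) {g : Cp X}
    (hg : SelFin (SeqDenseSets (Cp X)) (OmegaAt g)) :
    SelFin (ShrinkableGammaCovers X) (OpenOmegaCovers X) := by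
  intro 𝒰 h𝒰
  have : Nonempty (Cp X) := ⟨g⟩
  obtain ⟨d, hd⟩ := hsep.exists_seq
  choose U Z hU hZ hZU hlim using fun n => exists_seq_of_mem_shrinkableGammaCovers (h𝒰 n)
  have isCozeroSet_U (n m : ℕ) : IsCozeroSet (U n m) := (h𝒰 n).1 _ (hU n m)
  choose f hfZ hfU using fun n m =>
    (hZ n m).exists_cp_eqOn_eqOn (isCozeroSet_U n m) (hZU n m) (d m)
      ((1 : ℝ) +ᵥ g)
  obtain ⟨F, hF⟩ := hg.exists_finset_frequently (omegaAt_subset_accumulatingAt g) (s := f)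
    fun n => Or.inl (range_mem_seqDenseSets_of_eqOn hd (hlim n) (hfZ n))
  refine ⟨fun n => U n '' F n, fun n => ⟨(F n).finite_toSet.image _,
    image_subset_iff.2 fun m _ => hU n m⟩,
    mem_openOmegaCovers_of_forall_finite ?_ ?_ fun K hK => ?_⟩
  · rintro V hV
    obtain ⟨n, m, -, rfl⟩ := mem_iUnion.1 hV
    exact (isCozeroSet_U n m).isOpen
  · rintro hV
    obtain ⟨n, m, -, hm⟩ := mem_iUnion.1 hV
    exact (h𝒰 n).2.1.1.2 (hm ▸ hU n m)
  · obtain ⟨n, m, hm, hfm⟩ := (hF _ (Cp.eventually_abs_sub_lt g hK one_pos)).exists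
    refine ⟨U n m, mem_iUnion.2 ⟨n, mem_image_of_mem _ hm⟩, fun x hx => ?_⟩
    by_contra hxU
    have hlt : |(f n m).1 x - g.1 x| < 1 := hfm x hx
    rw [hfU n m hxU, Cp.vadd_apply, add_sub_cancel_right, abs_one] at hlt
    exact lt_irrefl 1 hlt

end CoverSelection

lemma separatesPoints_setOf_continuous (X : Type*) [TopologicalSpace X] [T35Space X] :
    {f : X → ℝ | Continuous f}.SeparatesPoints := by
  intro x y hxy
  obtain ⟨φ, hφ, hφx, hφy⟩ := CompletelyRegularSpace.completely_regular x {y}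
    isClosed_singleton hxy
  exact ⟨fun z => φ z, continuous_subtype_val.comp hφ, by simp [hφx, hφy (mem_singleton y)]⟩

theorem mainTheorem5_general (X : Type u) [TopologicalSpace X] [Nonempty X]
    (hX : {f : X → ℝ | Continuous f}.SeparatesPoints) :
    List.TFAE [
      SeqSeparable (Cp X) ∧ SelFin (SeqDenseSets (Cp X)) (DenseSets (Cp X)),
      SelFin (ShrinkableGammaCovers X) (OpenOmegaCovers X) ∧ PropertyV X,
      SeqSeparable (Cp X) ∧ ∀ g : Cp X, SelFin (GammaAt g) (OmegaAt g),
      SeqSeparable (Cp X) ∧ ∀ g : Cp X, SelFin (SeqDenseSets (Cp X)) (OmegaAt g)] := by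
  have : Nonempty (Cp X) := ⟨⟨fun _ => 0, continuous_const⟩⟩
  tfae_have 1 → 4 := fun ⟨hsep, h⟩ => ⟨hsep, fun g =>
    have := Cp.nhdsNE_neBot g
    h.omegaAt_of_denseSets⟩
  tfae_have 4 → 1 := fun ⟨hsep, h⟩ => ⟨hsep, selFin_denseSets_of_forall_omegaAt hsep h⟩
  tfae_have 4 → 2 := fun ⟨hsep, h⟩ =>
    ⟨hsep.selFin_covers (h (Classical.arbitrary (Cp X))), hsep.propertyV hX⟩
  tfae_have 2 → 3 := fun ⟨h, hV⟩ =>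
    ⟨hV.seqSeparable, fun g => (h.seqSelFin_nhds_of_covers g).selFin_gammaAt_omegaAt⟩
  tfae_have 3 → 4 := fun ⟨hsep, h⟩ => ⟨hsep, fun g =>
    (seqSelFin_nhds_of_selFin_gammaAt_omegaAt (h g)).selFin_seqDenseSets_omegaAt
      (tendsto_one_div_add_atTop_nhds_zero_nat (𝕜 := ℝ))
      fun n => Cp.vadd_ne g (Nat.one_div_pos_of_nat (α := ℝ)).ne'⟩
  tfae_finish

theorem mainTheorem5 (X : Type u) [TopologicalSpace X] [T35Space X] [Nonempty X] :
    List.TFAE [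
      SeqSeparable (Cp X) ∧ SelFin (SeqDenseSets (Cp X)) (DenseSets (Cp X)),
      SelFin (ShrinkableGammaCovers X) (OpenOmegaCovers X) ∧ PropertyV X,
      SeqSeparable (Cp X) ∧ ∀ g : Cp X, SelFin (GammaAt g) (OmegaAt g),
      SeqSeparable (Cp X) ∧ ∀ g : Cp X, SelFin (SeqDenseSets (Cp X)) (OmegaAt g)] :=
  mainTheorem5_general X (separatesPoints_setOf_continuous X)
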